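/- Let $n\ge 2$ and $d\ge 1$ be integers and let $V_1,\dots,V_n$ be i.i.d. random vectors in $\mathbb{R}^d$. Write $[v]_j$ for the $j$-th coordinate of a vector $v$, let $\bar V:=\frac1n\sum_{i=1}^n V_i$, and let $\nu:=\mathbb{E}[V_i]$ (which exists under either boundedness assumption below). Then: 1. If $C$ is a constant with $\|V_i\|_2\le C$ almost surely for every $i$, then for all $\delta\in(0,1)$, $$\mathbb{P}\left(\|\bar V-\nu\|_2>\frac{2\sqrt{\sum_{i=1}^n\|V_i-\bar V\|_2^2\,\ln\frac6\delta}}{n}+\frac{10\,C\ln\frac6\delta}{n-1}\right)\le\delta .$$ 2. If $C_1,\dots,C_d$ are constants with $|[V_i]_j|\le C_j$ for all $j\in\{1,\dots,d\}$ almost surely, for every $i$, then for all $\delta\in(0,1)$, (a) $$\mathbb{P}\left(\|\bar V-\nu\|_\infty>\max_{1\le j\le d}\left(\frac{\sqrt{2\sum_{i=1}^n[V_i-\bar V]_j^2\,\ln\frac{4d}\delta}}{n-1}+\frac{14\,C_j\ln\frac{4d}\delta}{3(n-1)}\right)\right)\le\delta ,$$ (b) $$\mathbb{P}\left(\|\bar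 V-\nu\|_1>\sum_{j=1}^d\left(\frac{\frac94\sqrt{2\sum_{i=1}^n[V_i-\bar V]_j^2\,\ln\frac{30}\delta}}{n-1}+\frac{25\,C_j\ln\frac{30}\delta}{n-1}\right)\right)\le\delta .$$ -/

import Mathlib

open MeasureTheory ProbabilityTheory
open scoped ENNReal

noncomputable section

/-- The `ℓ_p` norm of a vector of `ℝ^d`. -/
def vecNorm {d : ℕ} (p : ℝ≥0∞) (x : Fin d → ℝ) : ℝ :=
  ‖(WithLp.toLp p x : PiLp p (fun _ : Fin d => ℝ))‖

/-- The sample mean `(1/n) ∑ i, V i` of random vectors `V 0, …, V (n-1)`. -/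
def sampleMean {Ω : Type*} {n d : ℕ} (V : Fin n → Ω → Fin d → ℝ) (ω : Ω) : Fin d → ℝ :=
  (1 / (n : ℝ)) • ∑ i, V i ω

end

/-!
Pinelis' argument bounds the conditional mean of `cosh (λ ‖y + X‖)` for a centered step `X` in a
Hilbert space, and hence gives Bernstein's inequality for the norm of a sum of independent vectors
with the true variance. For the lower tail of the empirical variance, Hoeffding's device writes
it as the average over all permutations `σ` of the means of `‖V (σ i) - V (σ j)‖² / 2` over
disjoint pairs; for each `σ` the summands are independent, and Jensen's inequality removes the
average. This allows replacing the true variance by the empirical one.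

Both steps come with exponential moments `𝔼 exp (Z / Λ) ≤ p`, and such certificates add up: by
Jensen's inequality the sum of the `Z j` is positive with probability at most `p`, whatever their
dependence and their number. This is why the `ℓ₁` bound has no dimension factor in its logarithm.
-/

section HyperbolicInequalities

theorem convexOn_cosh_sqrt : ConvexOn ℝ (Set.Ici 0) fun u : ℝ => Real.cosh √u := by
  have hasSum : ∀ u : ℝ, 0 ≤ u →
      HasSum (fun k : ℕ => u ^ k / ((2 * k).factorial : ℝ)) (Real.cosh √u) := by
    intro u hu
    simpa only [pow_mul, Real.sq_sqrt hu] using Real.hasSum_cosh √u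
  refine ⟨convex_Ici 0, fun u (hu : 0 ≤ u) v (hv : 0 ≤ v) a b ha hb hab => ?_⟩
  simp only [smul_eq_mul]
  refine hasSum_le (fun k => ?_) (hasSum (a * u + b * v) (by positivity))
    (((hasSum u hu).mul_left a).add ((hasSum v hv).mul_left b))
  have hpow := (convexOn_pow k).2 hu hv ha hb hab
  simp only [smul_eq_mul] at hpow
  rw [mul_div_assoc', mul_div_assoc', ← add_div]
  gcongr

variable {E : Type*} [NormedAddCommGroup E] [InnerProductSpace ℝ E]

theorem cosh_norm_add_le_cosh_mul_cosh_add (x h : E) :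
    Real.cosh ‖x + h‖ ≤ Real.cosh ‖x‖ * Real.cosh ‖h‖ +
      Real.cos (InnerProductGeometry.angle x h) * (Real.sinh ‖x‖ * Real.sinh ‖h‖) := by
  set c := Real.cos (InnerProductGeometry.angle x h)
  have hc1 : c ≤ 1 := Real.cos_le_one _
  have hc2 : -1 ≤ c := Real.neg_one_le_cos _
  have norm_sq_eq : ‖x + h‖ ^ 2 =
      (1 + c) / 2 * (‖x‖ + ‖h‖) ^ 2 + (1 - c) / 2 * (‖x‖ - ‖h‖) ^ 2 := by
    rw [norm_add_sq_real, ← InnerProductGeometry.cos_angle_mul_norm_mul_norm x h]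
    ring
  have convexity := convexOn_cosh_sqrt.2 (Set.mem_Ici.2 (sq_nonneg (‖x‖ + ‖h‖)))
    (Set.mem_Ici.2 (sq_nonneg (‖x‖ - ‖h‖))) (show 0 ≤ (1 + c) / 2 by linarith)
    (show 0 ≤ (1 - c) / 2 by linarith) (by ring)
  simp only [smul_eq_mul, ← norm_sq_eq, Real.sqrt_sq_eq_abs, Real.cosh_abs] at convexity
  rw [Real.cosh_add, Real.cosh_sub] at convexity
  linarith

/-- The gradient of `x ↦ cosh ‖x‖`. At `0`, where the quotient is the junk value `0 / 0`, it still
is the gradient. -/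
noncomputable def coshNormGrad (x : E) : E := (Real.sinh ‖x‖ / ‖x‖) • x

theorem norm_coshNormGrad (x : E) : ‖coshNormGrad x‖ = Real.sinh ‖x‖ := by
  rcases eq_or_ne x 0 with rfl | hx
  · simp [coshNormGrad]
  · rw [coshNormGrad, norm_smul, norm_div, norm_norm, Real.norm_eq_abs, Real.abs_sinh, abs_norm,
      div_mul_cancel₀ _ (norm_ne_zero_iff.2 hx)]

theorem measurable_coshNormGrad [MeasurableSpace E] [BorelSpace E] [SecondCountableTopology E] :
    Measurable (coshNormGrad : E → E) := by
  unfold coshNormGrad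
  fun_prop

theorem inner_coshNormGrad (x h : E) :
    inner ℝ (coshNormGrad x) h =
      Real.cos (InnerProductGeometry.angle x h) * (Real.sinh ‖x‖ * ‖h‖) := by
  rcases eq_or_ne x 0 with rfl | hx
  · simp [coshNormGrad]
  · rw [coshNormGrad, real_inner_smul_left, ← InnerProductGeometry.cos_angle_mul_norm_mul_norm]
    field_simp [norm_ne_zero_iff.2 hx]

theorem cosh_norm_add_le (x h : E) :
    Real.cosh ‖x + h‖ ≤ Real.cosh ‖x‖ + inner ℝ (coshNormGrad x) h
      + Real.cosh ‖x‖ * (Real.exp ‖h‖ - 1 - ‖h‖) := by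
  rw [inner_coshNormGrad, ← Real.cosh_add_sinh ‖h‖]
  refine (cosh_norm_add_le_cosh_mul_cosh_add x h).trans ?_
  set c := Real.cos (InnerProductGeometry.angle x h)
  have cos_mul_sinh_le : c * Real.sinh ‖x‖ ≤ Real.cosh ‖x‖ :=
    calc c * Real.sinh ‖x‖ ≤ 1 * Real.sinh ‖x‖ := by
          gcongr
          exact Real.cos_le_one _
      _ ≤ Real.cosh ‖x‖ := by rw [one_mul]; exact (Real.sinh_lt_cosh _).le
  have sinh_sub_nonneg : 0 ≤ Real.sinh ‖h‖ - ‖h‖ :=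
    sub_nonneg.2 (Real.self_le_sinh_iff.2 (norm_nonneg h))
  linarith [mul_le_mul_of_nonneg_right cos_mul_sinh_le sinh_sub_nonneg]

end HyperbolicInequalities

section ExponentialInequalities

variable {x : ℝ}

theorem exp_sub_one_sub_nonneg (x : ℝ) : 0 ≤ Real.exp x - 1 - x := by
  linarith [Real.add_one_le_exp x]

theorem exp_sub_one_sub_le (hx : 0 ≤ x) (hx3 : x < 3) :
    Real.exp x - 1 - x ≤ x ^ 2 / (2 * (1 - x / 3)) := by
  have geometric : HasSum (fun k : ℕ => x ^ 2 / 2 * (x / 3) ^ k) (x ^ 2 / (2 * (1 - x / 3))) := by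
    rw [div_mul_eq_div_div, div_eq_mul_inv (x ^ 2 / 2)]
    refine (hasSum_geometric_of_abs_lt_one ?_).mul_left _
    rw [abs_of_nonneg (by positivity)]
    linarith
  have exponential :
      HasSum (fun k : ℕ => x ^ (k + 2) / ((k + 2).factorial : ℝ)) (Real.exp x - 1 - x) := by
    have hasSum_exp : HasSum (fun k : ℕ => x ^ k / (k.factorial : ℝ)) (Real.exp x) := by
      rw [Real.exp_eq_exp_ℝ]
      exact NormedSpace.expSeries_div_hasSum_exp x
    simpa [Finset.sum_range_succ, sub_sub] using (hasSum_nat_add_iff' 2).2 hasSum_exp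
  refine hasSum_le (fun k => ?_) exponential geometric
  have two_mul_pow_le : (2 * 3 ^ k : ℝ) ≤ ((k + 2).factorial : ℝ) := by
    rw [add_comm k 2]
    exact_mod_cast Nat.factorial_mul_pow_le_factorial (m := 2) (n := k)
  rw [div_pow, div_mul_div_comm, ← pow_add, add_comm 2 k]
  gcongr

theorem exp_neg_le_quadratic (hx : 0 ≤ x) : Real.exp (-x) ≤ 1 - x + x ^ 2 / 2 := by
  have hpos : 0 < 1 - x + x ^ 2 / 2 := by nlinarith [sq_nonneg (x - 1)]
  rw [Real.exp_neg, inv_le_comm₀ (Real.exp_pos _) hpos]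
  refine le_trans ?_ (Real.quadratic_le_exp_of_nonneg hx)
  rw [inv_le_iff_one_le_mul₀ hpos]
  nlinarith [sq_nonneg (x ^ 2)]

theorem exp_sub_sqrt_le {θ σ u : ℝ} (hθ : 0 ≤ θ) (hσ : 0 < σ) (hu : 0 ≤ u) :
    Real.exp (θ * (σ - √u)) ≤ 1 + Real.exp (θ * σ) * Real.exp (-(θ / σ * u)) := by
  rw [← Real.exp_add]
  rcases le_total σ √u with h | h
  · have : Real.exp (θ * (σ - √u)) ≤ 1 :=
      Real.exp_le_one_iff.2 (mul_nonpos_of_nonneg_of_nonpos hθ (by linarith))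
    linarith [Real.exp_pos (θ * σ + -(θ / σ * u))]
  · have div_le_sqrt : θ / σ * u ≤ θ * √u := by
      rw [div_mul_eq_mul_div, mul_div_assoc]
      gcongr
      rw [div_le_iff₀ hσ]
      calc u = √u * √u := (Real.mul_self_sqrt hu).symm
        _ ≤ √u * σ := by gcongr
    have : Real.exp (θ * (σ - √u)) ≤ Real.exp (θ * σ + -(θ / σ * u)) :=
      Real.exp_le_exp.2 (by linarith)
    linarith

end ExponentialInequalities

section EmpiricalVariance

variable {E ι : Type*} [NormedAddCommGroup E] [InnerProductSpace ℝ E] [Fintype ι]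

/-- The mean of a finite family of vectors. -/
noncomputable def empiricalMean (x : ι → E) : E := (1 / (Fintype.card ι : ℝ)) • ∑ i, x i

/-- The unbiased sample variance of a finite family of vectors, normalized by the number of vectors
minus one; it is only meaningful for at least two vectors. -/
noncomputable def empiricalVariance (x : ι → E) : ℝ :=
  (∑ i, ‖x i - empiricalMean x‖ ^ 2) / ((Fintype.card ι : ℝ) - 1)

theorem one_lt_card_cast (ι : Type*) [Fintype ι] [Nontrivial ι] : (1 : ℝ) < Fintype.card ι := by
  exact_mod_cast Fintype.one_lt_card

theorem card_sub_one_pos (ι : Type*) [Fintype ι] [Nontrivial ι] :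
    (0 : ℝ) < (Fintype.card ι : ℝ) - 1 :=
  sub_pos.2 (one_lt_card_cast ι)

theorem empiricalMean_sub [Nonempty ι] (x : ι → E) (a : E) :
    empiricalMean x - a = (1 / (Fintype.card ι : ℝ)) • ∑ i, (x i - a) := by
  rw [Finset.sum_sub_distrib, smul_sub, Finset.sum_const, Finset.card_univ,
    ← Nat.cast_smul_eq_nsmul ℝ, smul_smul, one_div_mul_cancel (by simp), one_smul, empiricalMean]

theorem sum_sub_empiricalMean [Nonempty ι] (x : ι → E) : ∑ i, (x i - empiricalMean x) = 0 := by
  rw [Finset.sum_sub_distrib, Finset.sum_const, Finset.card_univ, ← Nat.cast_smul_eq_nsmul ℝ,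
    empiricalMean, smul_smul, mul_one_div_cancel (by simp), one_smul, sub_self]

theorem sum_sum_norm_sub_sq [Nonempty ι] (x : ι → E) :
    ∑ i, ∑ j, ‖x i - x j‖ ^ 2 = 2 * Fintype.card ι * ∑ i, ‖x i - empiricalMean x‖ ^ 2 := by
  set y : ι → E := fun i => x i - empiricalMean x
  have expand : ∀ i j, ‖x i - x j‖ ^ 2 = ‖y i‖ ^ 2 - 2 * inner ℝ (y i) (y j) + ‖y j‖ ^ 2 :=
    fun i j => by rw [← norm_sub_sq_real, sub_sub_sub_cancel_right]
  have sum_y : ∑ i, y i = 0 := sum_sub_empiricalMean x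
  simp only [expand, Finset.sum_add_distrib, Finset.sum_sub_distrib, ← Finset.mul_sum,
    ← inner_sum, sum_y, inner_zero_right, Finset.sum_const, Finset.card_univ, nsmul_eq_mul]
  ring

variable [Nontrivial ι]

theorem empiricalVariance_nonneg (x : ι → E) : 0 ≤ empiricalVariance x :=
  div_nonneg (Finset.sum_nonneg fun _ _ => sq_nonneg _) (card_sub_one_pos ι).le

theorem sum_sum_norm_sub_sq_eq_empiricalVariance (x : ι → E) :
    ∑ i, ∑ j, ‖x i - x j‖ ^ 2 =
      Fintype.card ι * (Fintype.card ι - 1) * (2 * empiricalVariance x) := by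
  rw [sum_sum_norm_sub_sq, empiricalVariance]
  field_simp [(card_sub_one_pos ι).ne']

end EmpiricalVariance

section PairAveraging

variable {ι : Type*} [Fintype ι] [DecidableEq ι]

theorem sum_perm_apply_pair_eq (g : ι → ι → ℝ) {i j k l : ι} (hij : i ≠ j) (hkl : k ≠ l) :
    ∑ σ : Equiv.Perm ι, g (σ k) (σ l) = ∑ σ : Equiv.Perm ι, g (σ i) (σ j) := by
  obtain ⟨τ, rfl, rfl⟩ : ∃ τ : Equiv.Perm ι, τ k = i ∧ τ l = j := by
    simpa using (MulAction.is_two_pretransitive_iff (G := Equiv.Perm ι) (α := ι)).1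
      (Equiv.Perm.isMultiplyPretransitive ι 2) hkl hij
  simpa using (Equiv.sum_comp (Equiv.mulRight τ) fun σ : Equiv.Perm ι => g (σ k) (σ l)).symm

theorem sum_perm_apply_pair (g : ι → ι → ℝ) (hg : ∀ i, g i i = 0) {i j : ι} (hij : i ≠ j) :
    (Fintype.card ι : ℝ) * (Fintype.card ι - 1) * ∑ σ : Equiv.Perm ι, g (σ i) (σ j) =
      (Fintype.card (Equiv.Perm ι) : ℝ) * ∑ k, ∑ l, g k l := by
  have row : ∀ k, ∑ l, ∑ σ : Equiv.Perm ι, g (σ k) (σ l) =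
      (Fintype.card ι - 1) * ∑ σ : Equiv.Perm ι, g (σ i) (σ j) := by
    intro k
    rw [← Finset.add_sum_erase _ _ (Finset.mem_univ k), Finset.sum_congr rfl fun l hl =>
      sum_perm_apply_pair_eq g hij (Finset.ne_of_mem_erase hl).symm]
    simp only [hg, Finset.sum_const_zero, zero_add, Finset.sum_const, nsmul_eq_mul]
    rw [Finset.card_erase_of_mem (Finset.mem_univ k), Finset.card_univ,
      Nat.cast_pred (Fintype.card_pos_iff.2 ⟨k⟩)]
  calc _ = ∑ k, ∑ l, ∑ σ : Equiv.Perm ι, g (σ k) (σ l) := by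
        simp only [row, Finset.sum_const, Finset.card_univ, nsmul_eq_mul]
        ring
    _ = ∑ σ : Equiv.Perm ι, ∑ k, ∑ l, g (σ k) (σ l) := by
        rw [Finset.sum_comm (s := (Finset.univ : Finset (Equiv.Perm ι)))]
        exact Finset.sum_congr rfl fun k _ => Finset.sum_comm
    _ = ∑ σ : Equiv.Perm ι, ∑ k, ∑ l, g k l := by
        refine Finset.sum_congr rfl fun σ _ => ?_
        rw [Equiv.sum_comp σ fun k => ∑ l, g k (σ l)]
        exact Finset.sum_congr rfl fun k _ => Equiv.sum_comp σ (g k)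
    _ = _ := by simp only [Finset.sum_const, Finset.card_univ, nsmul_eq_mul]

variable {E : Type*} [NormedAddCommGroup E] [InnerProductSpace ℝ E] [Nontrivial ι]

theorem sum_perm_norm_sub_sq (x : ι → E) {i j : ι} (hij : i ≠ j) :
    ∑ σ : Equiv.Perm ι, ‖x (σ i) - x (σ j)‖ ^ 2 =
      Fintype.card (Equiv.Perm ι) * (2 * empiricalVariance x) := by
  have average := sum_perm_apply_pair (fun i j => ‖x i - x j‖ ^ 2) (by simp) hij
  have hpos : (0 : ℝ) < Fintype.card ι * (Fintype.card ι - 1) :=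
    mul_pos (one_pos.trans (one_lt_card_cast ι)) (card_sub_one_pos ι)
  rw [sum_sum_norm_sub_sq_eq_empiricalVariance] at average
  exact mul_left_cancel₀ hpos.ne' (average.trans (by ring))

theorem exp_neg_empiricalVariance_le_average {κ : Type*} [Fintype κ] (e : κ × Bool ↪ ι)
    (x : ι → E) (τ : ℝ) :
    Real.exp (-(τ * (Fintype.card κ * empiricalVariance x))) ≤
      ∑ σ : Equiv.Perm ι, (1 / Fintype.card (Equiv.Perm ι) : ℝ) *
        Real.exp (-(τ * ∑ k, ‖x (σ (e (k, true))) - x (σ (e (k, false)))‖ ^ 2 / 2)) := by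
  have hcard : (Fintype.card (Equiv.Perm ι) : ℝ) ≠ 0 := by simp
  have average : Fintype.card κ * empiricalVariance x = ∑ σ : Equiv.Perm ι,
      (1 / Fintype.card (Equiv.Perm ι) : ℝ) *
        ∑ k, ‖x (σ (e (k, true))) - x (σ (e (k, false)))‖ ^ 2 / 2 := by
    have ne : ∀ k, e (k, true) ≠ e (k, false) := fun k h => by simpa using e.injective h
    rw [← Finset.mul_sum, Finset.sum_comm]
    simp only [← Finset.sum_div, sum_perm_norm_sub_sq x (ne _), Finset.sum_const,
      Finset.card_univ, nsmul_eq_mul]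
    field_simp
  rw [average, Finset.mul_sum, ← Finset.sum_neg_distrib]
  simp only [mul_left_comm τ, ← mul_neg]
  refine convexOn_exp.map_sum_le (fun _ _ => by positivity) ?_ fun _ _ => Set.mem_univ _
  rw [Finset.sum_const, Finset.card_univ, nsmul_eq_mul, mul_one_div_cancel hcard]

end PairAveraging

section IntegrabilityAndIndependence

variable {Ω : Type*} [MeasurableSpace Ω] {μ : Measure Ω}

theorem integrable_comp_norm_of_ae_le [IsFiniteMeasure μ] {E : Type*} [NormedAddCommGroup E]
    {X : Ω → E} {g : ℝ → ℝ} {b : ℝ} (hg : Continuous g) (hX : AEStronglyMeasurable X μ)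
    (hb : ∀ᵐ ω ∂μ, ‖X ω‖ ≤ b) : Integrable (fun ω => g ‖X ω‖) μ := by
  obtain ⟨K, hK⟩ := (isCompact_Icc (a := 0) (b := b)).exists_bound_of_continuousOn hg.continuousOn
  refine Integrable.of_bound (hg.comp_aestronglyMeasurable hX.norm) K ?_
  filter_upwards [hb] with ω hω
  exact hK _ ⟨norm_nonneg _, hω⟩

theorem ae_norm_sum_le {E ι : Type*} [SeminormedAddCommGroup E] {X : ι → Ω → E} {b : ℝ}
    (hb : ∀ i, ∀ᵐ ω ∂μ, ‖X i ω‖ ≤ b) (s : Finset ι) :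
    ∀ᵐ ω ∂μ, ‖∑ i ∈ s, X i ω‖ ≤ s.card * b := by
  filter_upwards [(Finset.eventually_all s).2 fun i _ => hb i] with ω hω
  exact (norm_sum_le_of_le s hω).trans_eq (by rw [Finset.sum_const, nsmul_eq_mul])

theorem integral_inner_eq_zero_of_indepFun {E : Type*} [NormedAddCommGroup E]
    [InnerProductSpace ℝ E] [CompleteSpace E] [MeasurableSpace E] [BorelSpace E] {X Y : Ω → E}
    (hXY : IndepFun X Y μ) (hX : Integrable X μ) (hY : Integrable Y μ)
    (hmean : ∫ ω, Y ω ∂μ = 0) : ∫ ω, inner ℝ (X ω) (Y ω) ∂μ = 0 := by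
  have := hXY.integral_bilin hX hY (innerSL ℝ)
  rwa [hmean, map_zero] at this

theorem iIndepFun_curry {ι κ F : Type*} [MeasurableSpace F] {X : ι × κ → Ω → F}
    (hX : ∀ p, Measurable (X p)) (h : iIndepFun X μ) :
    iIndepFun (fun i ω j => X (i, j) ω) μ := by
  have := h.isProbabilityMeasure
  have isProb : ∀ i j, IsProbabilityMeasure (μ.map (X (i, j))) := fun i j =>
    Measure.isProbabilityMeasure_map (hX _).aemeasurable
  have row_law : ∀ i,
      μ.map (fun ω j => X (i, j) ω) = Measure.infinitePi fun j => μ.map (X (i, j)) :=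
    fun i => (h.precomp (Prod.mk_right_injective i)).map_fun_eq_infinitePi_map fun j => hX (i, j)
  rw [iIndepFun_iff_map_fun_eq_infinitePi_map (by fun_prop)]
  simp only [row_law]
  rw [← Measure.infinitePi_map_curry fun i j => μ.map (X (i, j)),
    ← h.map_fun_eq_infinitePi_map hX, Measure.map_map (by fun_prop) (by fun_prop)]
  rfl

theorem integral_prod_comp_pair {κ F : Type*} [Fintype κ] [MeasurableSpace F]
    {W : κ × Bool → Ω → F} (hW : ∀ p, Measurable (W p)) (hindep : iIndepFun W μ) {f : F × F → ℝ}
    (hf : Measurable f) :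
    ∫ ω, ∏ k, f (W (k, true) ω, W (k, false) ω) ∂μ =
      ∏ k, ∫ ω, f (W (k, true) ω, W (k, false) ω) ∂μ := by
  have hg : Measurable fun z : Bool → F => f (z true, z false) := by fun_prop
  have indep_pairs : iIndepFun (fun k ω => f (W (k, true) ω, W (k, false) ω)) μ :=
    (iIndepFun_curry hW hindep).comp (fun _ z => f (z true, z false)) fun _ => hg
  exact indep_pairs.integral_fun_prod_eq_prod_integral fun k =>
    (hf.comp ((hW _).prodMk (hW _))).aestronglyMeasurable

end IntegrabilityAndIndependence

section ChernoffBounds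

variable {Ω ι : Type*} [MeasurableSpace Ω] {μ : Measure Ω} {p : ℝ}

/-- A certificate for `μ {ω | 0 < Z ω} ≤ p` by Markov's inequality: either `Z` is almost surely
nonpositive, or some exponential moment of `Z` is at most `p`. Unlike the tail bound itself,
certificates with the same `p` can be added up without increasing `p`. -/
def HasChernoffBound (Z : Ω → ℝ) (p : ℝ) (μ : Measure Ω) : Prop :=
  (∀ᵐ ω ∂μ, Z ω ≤ 0) ∨
    ∃ Λ > 0, Integrable (fun ω => Real.exp (Z ω / Λ)) μ ∧ ∫ ω, Real.exp (Z ω / Λ) ∂μ ≤ p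

theorem HasChernoffBound.const_mul {Z : Ω → ℝ} (h : HasChernoffBound Z p μ) {c : ℝ} (hc : 0 < c) :
    HasChernoffBound (fun ω => c * Z ω) p μ := by
  rcases h with h | ⟨Λ, hΛ, hint, hle⟩
  · left
    filter_upwards [h] with ω hω
    exact mul_nonpos_of_nonneg_of_nonpos hc.le hω
  · right
    refine ⟨c * Λ, mul_pos hc hΛ, ?_⟩
    simpa only [mul_div_mul_left _ _ hc.ne'] using ⟨hint, hle⟩

variable [IsFiniteMeasure μ]

/- Jensen's inequality for the convex combination with weights `Λ j / ∑ Λ` reduces the sum to the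
individual exponential moments, with no union bound. -/
theorem measure_sum_pos_le_of_integral_exp_le (s : Finset ι) {Z : ι → Ω → ℝ} {Λ : ι → ℝ}
    (hΛ : ∀ j ∈ s, 0 < Λ j) (hint : ∀ j ∈ s, Integrable (fun ω => Real.exp (Z j ω / Λ j)) μ)
    (hp : ∀ j ∈ s, ∫ ω, Real.exp (Z j ω / Λ j) ∂μ ≤ p) :
    μ {ω | 0 < ∑ j ∈ s, Z j ω} ≤ ENNReal.ofReal p := by
  rcases s.eq_empty_or_nonempty with rfl | hs
  · simp
  set A := ∑ j ∈ s, Λ j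
  have hA : 0 < A := Finset.sum_pos hΛ hs
  have weight_nonneg : ∀ j ∈ s, 0 ≤ Λ j / A := fun j hj => div_nonneg (hΛ j hj).le hA.le
  have sum_weight : ∑ j ∈ s, Λ j / A = 1 := by rw [← Finset.sum_div, div_self hA.ne']
  set G : Ω → ℝ := fun ω => ∑ j ∈ s, Λ j / A * Real.exp (Z j ω / Λ j)
  have G_nonneg : ∀ ω, 0 ≤ G ω := fun ω => Finset.sum_nonneg fun j hj =>
    mul_nonneg (weight_nonneg j hj) (Real.exp_pos _).le
  have integrable_G : Integrable G μ := integrable_finsetSum _ fun j hj => (hint j hj).const_mul _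
  have integral_G_le : ∫ ω, G ω ∂μ ≤ p :=
    calc ∫ ω, G ω ∂μ = ∑ j ∈ s, Λ j / A * ∫ ω, Real.exp (Z j ω / Λ j) ∂μ := by
          rw [integral_finsetSum _ fun j hj => (hint j hj).const_mul _]
          exact Finset.sum_congr rfl fun j _ => integral_const_mul _ _
      _ ≤ ∑ j ∈ s, Λ j / A * p := Finset.sum_le_sum fun j hj =>
          mul_le_mul_of_nonneg_left (hp j hj) (weight_nonneg j hj)
      _ = p := by rw [← Finset.sum_mul, sum_weight, one_mul]
  have jensen : ∀ ω, Real.exp ((∑ j ∈ s, Z j ω) / A) ≤ G ω := by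
    intro ω
    have sum_eq : (∑ j ∈ s, Z j ω) / A = ∑ j ∈ s, Λ j / A * (Z j ω / Λ j) := by
      rw [Finset.sum_div]
      refine Finset.sum_congr rfl fun j hj => ?_
      field_simp [(hΛ j hj).ne']
    rw [sum_eq]
    exact convexOn_exp.map_sum_le weight_nonneg sum_weight fun _ _ => Set.mem_univ _
  have subset : {ω | 0 < ∑ j ∈ s, Z j ω} ⊆ {ω | 1 ≤ G ω} := fun ω hω =>
    (Real.one_le_exp (div_pos hω hA).le).trans (jensen ω)
  have markov := mul_meas_ge_le_integral_of_nonneg (ae_of_all _ G_nonneg) integrable_G 1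
  rw [one_mul] at markov
  refine (measure_mono subset).trans ?_
  rw [ENNReal.le_ofReal_iff_toReal_le (measure_ne_top _ _)
    ((integral_nonneg G_nonneg).trans integral_G_le)]
  exact markov.trans integral_G_le

theorem measure_sum_pos_le_of_hasChernoffBound (s : Finset ι) {Z : ι → Ω → ℝ}
    (hZ : ∀ j ∈ s, HasChernoffBound (Z j) p μ) :
    μ {ω | 0 < ∑ j ∈ s, Z j ω} ≤ ENNReal.ofReal p := by
  classical
  set t := s.filter fun j => ¬ ∀ᵐ ω ∂μ, Z j ω ≤ 0
  have exponential : ∀ j ∈ t, ∃ Λ > 0, Integrable (fun ω => Real.exp (Z j ω / Λ)) μ ∧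
      ∫ ω, Real.exp (Z j ω / Λ) ∂μ ≤ p := fun j hj =>
    (hZ j (Finset.mem_filter.1 hj).1).resolve_left (Finset.mem_filter.1 hj).2
  choose! Λ hΛ hint hp using exponential
  have nonpos : ∀ᵐ ω ∂μ, ∀ j ∈ s, j ∉ t → Z j ω ≤ 0 := by
    refine (Finset.eventually_all s).2 fun j hj => ?_
    by_cases hjt : j ∈ t
    · exact ae_of_all _ fun _ h => absurd hjt h
    · filter_upwards [not_not.1 fun h => hjt (Finset.mem_filter.2 ⟨hj, h⟩)] with ω hω _ using hω
  refine (measure_mono_ae ?_).trans (measure_sum_pos_le_of_integral_exp_le t hΛ hint hp)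
  filter_upwards [nonpos] with ω hω (hpos : 0 < ∑ j ∈ s, Z j ω)
  exact hpos.trans_le (Finset.sum_le_sum_of_subset_of_nonpos' (Finset.filter_subset _ s) hω)

end ChernoffBounds

section Bernstein

variable {Ω ι : Type*} [MeasurableSpace Ω] {μ : Measure Ω}

theorem integral_exp_mul_norm_sub_one_sub_le [IsFiniteMeasure μ] {F : Type*}
    [NormedAddCommGroup F] {X : Ω → F} {b t : ℝ} (hX : AEStronglyMeasurable X μ)
    (hb : ∀ᵐ ω ∂μ, ‖X ω‖ ≤ b) (ht : 0 ≤ t) (htb : t * b < 3) :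
    ∫ ω, (Real.exp (t * ‖X ω‖) - 1 - t * ‖X ω‖) ∂μ ≤
      t ^ 2 / (2 * (1 - t * b / 3)) * ∫ ω, ‖X ω‖ ^ 2 ∂μ := by
  rw [← integral_const_mul]
  refine integral_mono_of_nonneg (ae_of_all _ fun ω => exp_sub_one_sub_nonneg _)
    ((integrable_comp_norm_of_ae_le (continuous_pow 2) hX hb).const_mul _) ?_
  filter_upwards [hb] with ω hω
  have mul_norm_le : t * ‖X ω‖ ≤ t * b := by gcongr
  refine (exp_sub_one_sub_le (by positivity) (mul_norm_le.trans_lt htb)).trans ?_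
  rw [div_mul_eq_mul_div, ← mul_pow]
  gcongr
  linarith

theorem ae_eq_zero_of_integral_norm_sq_eq_zero [IsFiniteMeasure μ] {F : Type*}
    [NormedAddCommGroup F] {X : Ω → F} {b : ℝ} (hX : AEStronglyMeasurable X μ)
    (hb : ∀ᵐ ω ∂μ, ‖X ω‖ ≤ b) (h : ∫ ω, ‖X ω‖ ^ 2 ∂μ = 0) : ∀ᵐ ω ∂μ, X ω = 0 := by
  have integrable_sq : Integrable (fun ω => ‖X ω‖ ^ 2) μ :=
    integrable_comp_norm_of_ae_le (continuous_pow 2) hX hb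
  have norm_sq_zero : (fun ω => ‖X ω‖ ^ 2) =ᵐ[μ] 0 :=
    (integral_eq_zero_iff_of_nonneg (fun ω => sq_nonneg ‖X ω‖) integrable_sq).1 h
  filter_upwards [norm_sq_zero] with ω hω
  exact norm_eq_zero.1 (pow_eq_zero_iff two_ne_zero |>.1 hω)

variable {E : Type*} [NormedAddCommGroup E] [InnerProductSpace ℝ E] [CompleteSpace E]
  [MeasurableSpace E] [BorelSpace E] [SecondCountableTopology E]

theorem integral_cosh_norm_add_le [IsFiniteMeasure μ] {S W : Ω → E} {b c : ℝ}
    (hS : Measurable S) (hW : Measurable W) (hindep : IndepFun S W μ)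
    (hSb : ∀ᵐ ω ∂μ, ‖S ω‖ ≤ b) (hWc : ∀ᵐ ω ∂μ, ‖W ω‖ ≤ c) (hmean : ∫ ω, W ω ∂μ = 0) :
    ∫ ω, Real.cosh ‖S ω + W ω‖ ∂μ ≤
      (∫ ω, Real.cosh ‖S ω‖ ∂μ) * (1 + ∫ ω, (Real.exp ‖W ω‖ - 1 - ‖W ω‖) ∂μ) := by
  have integrable_cosh : Integrable (fun ω => Real.cosh ‖S ω‖) μ :=
    integrable_comp_norm_of_ae_le Real.continuous_cosh hS.aestronglyMeasurable hSb
  have integrable_exp : Integrable (fun ω => Real.exp ‖W ω‖ - 1 - ‖W ω‖) μ :=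
    integrable_comp_norm_of_ae_le (g := fun x => Real.exp x - 1 - x) (by fun_prop)
      hW.aestronglyMeasurable hWc
  have integrable_cosh_add : Integrable (fun ω => Real.cosh ‖S ω + W ω‖) μ := by
    refine integrable_comp_norm_of_ae_le (b := b + c) Real.continuous_cosh
      (hS.add hW).aestronglyMeasurable ?_
    filter_upwards [hSb, hWc] with ω h1 h2 using norm_add_le_of_le h1 h2
  have integrable_W : Integrable W μ := Integrable.of_bound hW.aestronglyMeasurable c hWc
  have integrable_grad : Integrable (fun ω => coshNormGrad (S ω)) μ :=
    integrable_cosh.mono' (measurable_coshNormGrad.comp hS).aestronglyMeasurable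
      (ae_of_all _ fun ω => (norm_coshNormGrad (S ω)).trans_le (Real.sinh_lt_cosh _).le)
  have indep_grad : IndepFun (fun ω => coshNormGrad (S ω)) W μ :=
    hindep.comp measurable_coshNormGrad measurable_id
  have integrable_inner : Integrable (fun ω => inner ℝ (coshNormGrad (S ω)) (W ω)) μ :=
    indep_grad.integrable_bilin integrable_grad integrable_W (innerSL ℝ)
  have integral_inner : ∫ ω, inner ℝ (coshNormGrad (S ω)) (W ω) ∂μ = 0 :=
    integral_inner_eq_zero_of_indepFun indep_grad integrable_grad integrable_W hmean
  have indep_norm : IndepFun (fun ω => Real.cosh ‖S ω‖) (fun ω => Real.exp ‖W ω‖ - 1 - ‖W ω‖) μ :=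
    hindep.comp (φ := fun x => Real.cosh ‖x‖) (ψ := fun x => Real.exp ‖x‖ - 1 - ‖x‖)
      (by fun_prop) (by fun_prop)
  have integrable_mul : Integrable
      (fun ω => Real.cosh ‖S ω‖ * (Real.exp ‖W ω‖ - 1 - ‖W ω‖)) μ :=
    indep_norm.integrable_mul integrable_cosh integrable_exp
  calc ∫ ω, Real.cosh ‖S ω + W ω‖ ∂μ
      ≤ ∫ ω, (Real.cosh ‖S ω‖ + inner ℝ (coshNormGrad (S ω)) (W ω)
          + Real.cosh ‖S ω‖ * (Real.exp ‖W ω‖ - 1 - ‖W ω‖)) ∂μ :=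
        integral_mono integrable_cosh_add
          ((integrable_cosh.add integrable_inner).add integrable_mul) fun ω => cosh_norm_add_le _ _
    _ = _ := by
        rw [integral_add (by exact integrable_cosh.add integrable_inner) integrable_mul,
          integral_add integrable_cosh integrable_inner, integral_inner,
          indep_norm.integral_fun_mul_eq_mul_integral integrable_cosh.aestronglyMeasurable
            integrable_exp.aestronglyMeasurable]
        ring

variable [IsProbabilityMeasure μ]

theorem integral_cosh_norm_sum_le {W : ι → Ω → E} {b : ℝ} (hW : ∀ i, Measurable (W i))
    (hindep : iIndepFun W μ) (hb : ∀ i, ∀ᵐ ω ∂μ, ‖W i ω‖ ≤ b) (hmean : ∀ i, ∫ ω, W i ω ∂μ = 0)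
    (s : Finset ι) :
    ∫ ω, Real.cosh ‖∑ i ∈ s, W i ω‖ ∂μ ≤
      ∏ i ∈ s, (1 + ∫ ω, (Real.exp ‖W i ω‖ - 1 - ‖W i ω‖) ∂μ) := by
  classical
  induction s using Finset.induction_on with
  | empty => simp
  | insert a s ha ih =>
    have indep_sum : IndepFun (fun ω => ∑ i ∈ s, W i ω) (W a) μ := by
      simpa only [Finset.sum_fn] using hindep.indepFun_finsetSum_of_notMem hW ha
    simp only [Finset.sum_insert ha, Finset.prod_insert ha, add_comm (W a _)]
    refine (integral_cosh_norm_add_le (by fun_prop) (hW a) indep_sum (ae_norm_sum_le hb s) (hb a)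
      (hmean a)).trans ?_
    rw [mul_comm]
    gcongr
    exact add_nonneg zero_le_one (integral_nonneg fun ω => exp_sub_one_sub_nonneg _)

theorem integral_exp_norm_sum_le [Fintype ι] {X : ι → Ω → E} {b t : ℝ}
    (hX : ∀ i, Measurable (X i)) (hindep : iIndepFun X μ) (hb : ∀ i, ∀ᵐ ω ∂μ, ‖X i ω‖ ≤ b)
    (hmean : ∀ i, ∫ ω, X i ω ∂μ = 0) (ht : 0 ≤ t) (htb : t * b < 3) :
    ∫ ω, Real.exp (t * ‖∑ i, X i ω‖) ∂μ ≤
      2 * Real.exp (t ^ 2 / (2 * (1 - t * b / 3)) * ∑ i, ∫ ω, ‖X i ω‖ ^ 2 ∂μ) := by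
  have exp_le_cosh : ∀ ω,
      Real.exp (t * ‖∑ i, X i ω‖) ≤ 2 * Real.cosh ‖∑ i, t • X i ω‖ := fun ω => by
    rw [← Finset.smul_sum, norm_smul, Real.norm_of_nonneg ht, Real.cosh_eq]
    linarith [Real.exp_pos (-(t * ‖∑ i, X i ω‖))]
  have smul_bound : ∀ i, ∀ᵐ ω ∂μ, ‖t • X i ω‖ ≤ t * b := fun i => by
    filter_upwards [hb i] with ω hω
    rw [norm_smul, Real.norm_of_nonneg ht]
    gcongr
  have integrable_cosh : Integrable (fun ω => Real.cosh ‖∑ i, t • X i ω‖) μ :=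
    integrable_comp_norm_of_ae_le Real.continuous_cosh
      (by fun_prop : Measurable fun ω => ∑ i, t • X i ω).aestronglyMeasurable
      (ae_norm_sum_le smul_bound Finset.univ)
  calc ∫ ω, Real.exp (t * ‖∑ i, X i ω‖) ∂μ
      ≤ ∫ ω, 2 * Real.cosh ‖∑ i, t • X i ω‖ ∂μ :=
        integral_mono_of_nonneg (ae_of_all _ fun ω => (Real.exp_pos _).le)
          (integrable_cosh.const_mul 2) (ae_of_all _ exp_le_cosh)
    _ ≤ 2 * ∏ i, (1 + ∫ ω, (Real.exp (t * ‖X i ω‖) - 1 - t * ‖X i ω‖) ∂μ) := by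
        rw [integral_const_mul]
        gcongr
        have mean_smul : ∀ i, ∫ ω, t • X i ω ∂μ = 0 := fun i => by
          rw [integral_smul, hmean i, smul_zero]
        simpa only [norm_smul, Real.norm_of_nonneg ht] using
          integral_cosh_norm_sum_le (W := fun i ω => t • X i ω) (fun i => (hX i).const_smul t)
            (hindep.comp (fun _ x => t • x) fun _ => by fun_prop) smul_bound mean_smul Finset.univ
    _ ≤ 2 * ∏ i, Real.exp (t ^ 2 / (2 * (1 - t * b / 3)) * ∫ ω, ‖X i ω‖ ^ 2 ∂μ) := by
        gcongr with i
        · exact fun i _ =>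
            add_nonneg zero_le_one (integral_nonneg fun ω => exp_sub_one_sub_nonneg _)
        · rw [add_comm]
          exact (add_le_add_left (integral_exp_mul_norm_sub_one_sub_le
            (hX i).aestronglyMeasurable (hb i) ht htb) 1).trans (Real.add_one_le_exp _)
    _ = _ := by rw [← Real.exp_sum, Finset.mul_sum]

/- At the moment `1 / (b / 3 + a)` one has `1 - b / (3 * (b / 3 + a)) = a / (b / 3 + a)`, which
makes the Bernstein exponent exactly `-L`. -/
theorem integral_exp_norm_sum_sub_div_le [Fintype ι] {X : ι → Ω → E} {a b L : ℝ}
    (hX : ∀ i, Measurable (X i)) (hindep : iIndepFun X μ) (hb : ∀ i, ∀ᵐ ω ∂μ, ‖X i ω‖ ≤ b)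
    (hmean : ∀ i, ∫ ω, X i ω ∂μ = 0) (hb0 : 0 ≤ b) (ha : 0 < a)
    (hvar : ∑ i, ∫ ω, ‖X i ω‖ ^ 2 ∂μ = 2 * L * a ^ 2) :
    ∫ ω, Real.exp ((‖∑ i, X i ω‖ - (2 * L * a + b * L / 3)) / (b / 3 + a)) ∂μ ≤
      2 * Real.exp (-L) := by
  have hq : 0 < b / 3 + a := by positivity
  have factor : ∀ ω, Real.exp ((‖∑ i, X i ω‖ - (2 * L * a + b * L / 3)) / (b / 3 + a)) =
      Real.exp (-(2 * L * a + b * L / 3) / (b / 3 + a)) *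
        Real.exp (1 / (b / 3 + a) * ‖∑ i, X i ω‖) := fun ω => by
    rw [← Real.exp_add]
    ring_nf
  simp only [factor]
  rw [integral_const_mul]
  calc _ ≤ Real.exp (-(2 * L * a + b * L / 3) / (b / 3 + a)) * (2 * Real.exp
        ((1 / (b / 3 + a)) ^ 2 / (2 * (1 - 1 / (b / 3 + a) * b / 3)) * (2 * L * a ^ 2))) := by
        gcongr
        rw [← hvar]
        refine integral_exp_norm_sum_le hX hindep hb hmean (by positivity) ?_
        rw [one_div_mul_eq_div, div_lt_iff₀ hq]
        linarith
    _ = 2 * Real.exp (-L) := by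
        rw [mul_left_comm, ← Real.exp_add,
          show 1 - 1 / (b / 3 + a) * b / 3 = a / (b / 3 + a) by field_simp; ring]
        congr 2
        field_simp
        ring

theorem hasChernoffBound_norm_sum [Fintype ι] {X : ι → Ω → E} {b L : ℝ}
    (hX : ∀ i, Measurable (X i)) (hindep : iIndepFun X μ) (hb : ∀ i, ∀ᵐ ω ∂μ, ‖X i ω‖ ≤ b)
    (hmean : ∀ i, ∫ ω, X i ω ∂μ = 0) (hb0 : 0 ≤ b) (hL : 0 < L) :
    HasChernoffBound
      (fun ω => ‖∑ i, X i ω‖ - (√(2 * L * ∑ i, ∫ ω, ‖X i ω‖ ^ 2 ∂μ) + b * L / 3))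
      (2 * Real.exp (-L)) μ := by
  set w := ∑ i, ∫ ω, ‖X i ω‖ ^ 2 ∂μ
  have second_moment_nonneg : ∀ i ∈ Finset.univ, 0 ≤ ∫ ω, ‖X i ω‖ ^ 2 ∂μ :=
    fun i _ => integral_nonneg fun ω => sq_nonneg _
  rcases (Finset.sum_nonneg second_moment_nonneg : 0 ≤ w).eq_or_lt' with hw0 | hw0
  · left
    have ae_zero : ∀ᵐ ω ∂μ, ∀ i, X i ω = 0 := ae_all_iff.2 fun i =>
      ae_eq_zero_of_integral_norm_sq_eq_zero (hX i).aestronglyMeasurable (hb i)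
        ((Finset.sum_eq_zero_iff_of_nonneg second_moment_nonneg).1 hw0 i (Finset.mem_univ i))
    filter_upwards [ae_zero] with ω hω
    simp only [hω, Finset.sum_const_zero, norm_zero, zero_sub, neg_nonpos]
    positivity
  · right
    set a := √(w / (2 * L))
    have ha : 0 < a := Real.sqrt_pos.2 (by positivity)
    have w_eq : w = 2 * L * a ^ 2 := by
      rw [Real.sq_sqrt (by positivity), mul_div_cancel₀ _ (by positivity)]
    have sqrt_eq : √(2 * L * w) = 2 * L * a := by
      rw [w_eq, show 2 * L * (2 * L * a ^ 2) = (2 * L * a) ^ 2 by ring,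
        Real.sqrt_sq (by positivity)]
    rw [sqrt_eq]
    refine ⟨b / 3 + a, by positivity, ?_,
      integral_exp_norm_sum_sub_div_le hX hindep hb hmean hb0 ha w_eq⟩
    exact integrable_comp_norm_of_ae_le
      (g := fun x => Real.exp ((x - (2 * L * a + b * L / 3)) / (b / 3 + a))) (by fun_prop)
      (by fun_prop : Measurable fun ω => ∑ i, X i ω).aestronglyMeasurable
      (ae_norm_sum_le hb Finset.univ)

end Bernstein

section LaplaceTransform

variable {Ω : Type*} [MeasurableSpace Ω] {μ : Measure Ω}

theorem integral_exp_neg_mul_le [IsProbabilityMeasure μ] {D : Ω → ℝ} {B τ : ℝ}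
    (hD : AEStronglyMeasurable D μ) (hD0 : ∀ ω, 0 ≤ D ω) (hDB : ∀ᵐ ω ∂μ, D ω ≤ B) (hτ : 0 ≤ τ) :
    ∫ ω, Real.exp (-(τ * D ω)) ∂μ ≤ Real.exp (-((τ - τ ^ 2 * B / 2) * ∫ ω, D ω ∂μ)) := by
  have integrable_D : Integrable D μ := Integrable.of_bound hD B (by
    filter_upwards [hDB] with ω hω
    rwa [Real.norm_of_nonneg (hD0 ω)])
  have exp_neg_le : ∀ᵐ ω ∂μ, Real.exp (-(τ * D ω)) ≤ 1 - (τ - τ ^ 2 * B / 2) * D ω := by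
    filter_upwards [hDB] with ω hω
    have sq_le : τ ^ 2 * (D ω * D ω) ≤ τ ^ 2 * (B * D ω) := by
      gcongr
      exact hD0 ω
    linarith [exp_neg_le_quadratic (mul_nonneg hτ (hD0 ω))]
  calc ∫ ω, Real.exp (-(τ * D ω)) ∂μ ≤ ∫ ω, (1 - (τ - τ ^ 2 * B / 2) * D ω) ∂μ :=
        integral_mono_of_nonneg (ae_of_all _ fun ω => (Real.exp_pos _).le)
          ((integrable_const 1).sub (integrable_D.const_mul _)) exp_neg_le
    _ = 1 - (τ - τ ^ 2 * B / 2) * ∫ ω, D ω ∂μ := by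
        rw [integral_sub (integrable_const 1) (integrable_D.const_mul _), integral_const_mul,
          integral_const, probReal_univ, one_smul]
    _ ≤ _ := Real.one_sub_le_exp_neg _

theorem integral_norm_sub_sq_of_indepFun [IsFiniteMeasure μ] {E : Type*} [NormedAddCommGroup E]
    [InnerProductSpace ℝ E] [CompleteSpace E] [MeasurableSpace E] [BorelSpace E]
    {X Y : Ω → E} (hX : MemLp X 2 μ) (hY : MemLp Y 2 μ)
    (hXY : IndepFun X Y μ) (hmean : ∫ ω, Y ω ∂μ = 0) :
    ∫ ω, ‖X ω - Y ω‖ ^ 2 ∂μ = ∫ ω, ‖X ω‖ ^ 2 ∂μ + ∫ ω, ‖Y ω‖ ^ 2 ∂μ := by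
  have integrable_X : Integrable X μ := hX.integrable one_le_two
  have integrable_Y : Integrable Y μ := hY.integrable one_le_two
  have sq_X : Integrable (fun ω => ‖X ω‖ ^ 2) μ := hX.integrable_norm_pow two_ne_zero
  have sq_Y : Integrable (fun ω => ‖Y ω‖ ^ 2) μ := hY.integrable_norm_pow two_ne_zero
  have integrable_inner : Integrable (fun ω => inner ℝ (X ω) (Y ω)) μ :=
    hXY.integrable_bilin integrable_X integrable_Y (innerSL ℝ)
  have integral_inner : ∫ ω, inner ℝ (X ω) (Y ω) ∂μ = 0 :=
    integral_inner_eq_zero_of_indepFun hXY integrable_X integrable_Y hmean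
  simp only [norm_sub_sq_real]
  rw [integral_add (by exact sq_X.sub (integrable_inner.const_mul 2)) sq_Y,
    integral_sub sq_X (integrable_inner.const_mul 2), integral_const_mul, integral_inner]
  ring

end LaplaceTransform

section Samples

variable {Ω ι E : Type*} [MeasurableSpace Ω] [NormedAddCommGroup E] [InnerProductSpace ℝ E]
  [MeasurableSpace E]

/-- Independent random vectors `V i` with common mean `ν` and common total variance
`v = 𝔼 ‖V i - ν‖²`, almost surely bounded by `C` in norm. -/
structure BoundedSample (V : ι → Ω → E) (ν : E) (v C : ℝ) (μ : Measure Ω) : Prop where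
  measurable : ∀ i, Measurable (V i)
  iIndepFun : iIndepFun V μ
  ae_norm_le : ∀ i, ∀ᵐ ω ∂μ, ‖V i ω‖ ≤ C
  integral_eq : ∀ i, ∫ ω, V i ω ∂μ = ν
  integral_norm_sub_sq : ∀ i, ∫ ω, ‖V i ω - ν‖ ^ 2 ∂μ = v

namespace BoundedSample

variable {V : ι → Ω → E} {ν : E} {v C : ℝ} {μ : Measure Ω}

theorem variance_nonneg [Nonempty ι] (h : BoundedSample V ν v C μ) : 0 ≤ v := by
  rw [← h.integral_norm_sub_sq (Classical.arbitrary ι)]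
  exact integral_nonneg fun ω => sq_nonneg _

theorem ae_norm_sub_le (h : BoundedSample V ν v C μ) (i j : ι) :
    ∀ᵐ ω ∂μ, ‖V i ω - V j ω‖ ≤ 2 * C := by
  filter_upwards [h.ae_norm_le i, h.ae_norm_le j] with ω hi hj
  exact (norm_sub_le_of_le hi hj).trans_eq (two_mul C).symm

variable [IsProbabilityMeasure μ]

theorem norm_mean_le [Nonempty ι] (h : BoundedSample V ν v C μ) : ‖ν‖ ≤ C := by
  rw [← h.integral_eq (Classical.arbitrary ι)]
  simpa using norm_integral_le_of_norm_le_const (h.ae_norm_le _)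

theorem bound_nonneg [Nonempty ι] (h : BoundedSample V ν v C μ) : 0 ≤ C :=
  (norm_nonneg ν).trans h.norm_mean_le

theorem ae_norm_sub_mean_le (h : BoundedSample V ν v C μ) (i : ι) :
    ∀ᵐ ω ∂μ, ‖V i ω - ν‖ ≤ 2 * C := by
  have := Nonempty.intro i
  filter_upwards [h.ae_norm_le i] with ω hω
  exact (norm_sub_le_of_le hω h.norm_mean_le).trans_eq (two_mul C).symm

theorem variance_le [Nonempty ι] (h : BoundedSample V ν v C μ) : v ≤ (2 * C) ^ 2 := by
  have i : ι := Classical.arbitrary ι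
  have bound : ∀ᵐ ω ∂μ, ‖‖V i ω - ν‖ ^ 2‖ ≤ (2 * C) ^ 2 := by
    filter_upwards [h.ae_norm_sub_mean_le i] with ω hω
    rw [norm_pow, norm_norm]
    gcongr
  rw [← h.integral_norm_sub_sq i]
  simpa using (Real.le_norm_self _).trans (norm_integral_le_of_norm_le_const bound)

variable [BorelSpace E] [SecondCountableTopology E]

theorem memLp_sub_mean (h : BoundedSample V ν v C μ) (i : ι) :
    MemLp (fun ω => V i ω - ν) 2 μ :=
  MemLp.of_bound ((h.measurable i).sub_const ν).aestronglyMeasurable _ (h.ae_norm_sub_mean_le i)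

variable [CompleteSpace E]

theorem integral_sub_mean (h : BoundedSample V ν v C μ) (i : ι) : ∫ ω, (V i ω - ν) ∂μ = 0 := by
  have integrable_V : Integrable (V i) μ :=
    Integrable.of_bound (h.measurable i).aestronglyMeasurable C (h.ae_norm_le i)
  rw [integral_sub integrable_V (integrable_const ν), h.integral_eq, integral_const,
    probReal_univ, one_smul, sub_self]

theorem integral_norm_sub_sq_eq_two_mul (h : BoundedSample V ν v C μ) {i j : ι} (hij : i ≠ j) :
    ∫ ω, ‖V i ω - V j ω‖ ^ 2 ∂μ = 2 * v := by
  have indep_centered : IndepFun (fun ω => V i ω - ν) (fun ω => V j ω - ν) μ :=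
    (h.iIndepFun.indepFun hij).comp (φ := fun x => x - ν) (ψ := fun x => x - ν)
      (by fun_prop) (by fun_prop)
  have pythagoras := integral_norm_sub_sq_of_indepFun (h.memLp_sub_mean i) (h.memLp_sub_mean j)
    indep_centered (h.integral_sub_mean j)
  simpa only [sub_sub_sub_cancel_right, h.integral_norm_sub_sq, ← two_mul] using pythagoras

theorem integral_exp_neg_norm_sub_sq_le (h : BoundedSample V ν v C μ) {τ : ℝ} {i j : ι}
    (hij : i ≠ j) (hτ : 0 ≤ τ) :
    ∫ ω, Real.exp (-(τ * (‖V i ω - V j ω‖ ^ 2 / 2))) ∂μ ≤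
      Real.exp (-((τ - τ ^ 2 * C ^ 2) * v)) := by
  have := h.measurable
  have bound : ∀ᵐ ω ∂μ, ‖V i ω - V j ω‖ ^ 2 / 2 ≤ 2 * C ^ 2 := by
    filter_upwards [h.ae_norm_sub_le i j] with ω hω
    calc ‖V i ω - V j ω‖ ^ 2 / 2 ≤ (2 * C) ^ 2 / 2 := by gcongr
      _ = 2 * C ^ 2 := by ring
  refine (integral_exp_neg_mul_le (by fun_prop : Measurable
    fun ω => ‖V i ω - V j ω‖ ^ 2 / 2).aestronglyMeasurable (fun ω => by positivity) bound
    hτ).trans_eq ?_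
  rw [integral_div, h.integral_norm_sub_sq_eq_two_mul hij]
  ring_nf

theorem integral_exp_neg_sum_pairs_le (h : BoundedSample V ν v C μ) {κ : Type*} [Fintype κ]
    (e : κ × Bool ↪ ι) {τ : ℝ} (hτ : 0 ≤ τ) :
    ∫ ω, Real.exp (-(τ * ∑ k, ‖V (e (k, true)) ω - V (e (k, false)) ω‖ ^ 2 / 2)) ∂μ ≤
      Real.exp (-(Fintype.card κ * ((τ - τ ^ 2 * C ^ 2) * v))) := by
  simp only [Finset.mul_sum, ← Finset.sum_neg_distrib, Real.exp_sum]
  calc _ = ∏ k, ∫ ω, Real.exp (-(τ * (‖V (e (k, true)) ω - V (e (k, false)) ω‖ ^ 2 / 2))) ∂μ :=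
        integral_prod_comp_pair (W := fun p => V (e p))
          (f := fun z => Real.exp (-(τ * (‖z.1 - z.2‖ ^ 2 / 2)))) (fun p => h.measurable _)
          (h.iIndepFun.precomp e.injective) (by fun_prop)
    _ ≤ ∏ _k : κ, Real.exp (-((τ - τ ^ 2 * C ^ 2) * v)) :=
        Finset.prod_le_prod (fun k _ => integral_nonneg fun ω => (Real.exp_pos _).le) fun k _ =>
          h.integral_exp_neg_norm_sub_sq_le (fun hk => by simpa using e.injective hk) hτ
    _ = _ := by
        rw [Finset.prod_const, Finset.card_univ, ← Real.exp_nat_mul, mul_neg]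

end BoundedSample

theorem measurable_empiricalVariance [BorelSpace E] [SecondCountableTopology E] [Fintype ι]
    {V : ι → Ω → E} (hV : ∀ i, Measurable (V i)) :
    Measurable fun ω => empiricalVariance fun i => V i ω := by
  unfold empiricalVariance empiricalMean
  fun_prop

namespace BoundedSample

variable [BorelSpace E] [SecondCountableTopology E] [Fintype ι] {V : ι → Ω → E} {ν : E} {v C : ℝ}
  {μ : Measure Ω} [IsProbabilityMeasure μ]

theorem integrable_exp_mul_sqrt_sub_sqrt (h : BoundedSample V ν v C μ) {θ : ℝ} (hθ : 0 ≤ θ) :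
    Integrable (fun ω => Real.exp (θ * (√v - √(empiricalVariance fun i => V i ω)))) μ := by
  have measurable_U := measurable_empiricalVariance h.measurable
  refine Integrable.of_bound ((measurable_U.sqrt.const_sub _).const_mul _).exp.aestronglyMeasurable
    (Real.exp (θ * √v)) (ae_of_all _ fun ω => ?_)
  rw [Real.norm_of_nonneg (Real.exp_pos _).le]
  gcongr
  exact sub_le_self _ (Real.sqrt_nonneg _)

variable [CompleteSpace E] [Nontrivial ι]

theorem integral_exp_neg_card_mul_empiricalVariance_le (h : BoundedSample V ν v C μ) {κ : Type*}
    [Fintype κ] (e : κ × Bool ↪ ι) {τ : ℝ} (hτ : 0 ≤ τ) :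
    ∫ ω, Real.exp (-(τ * (Fintype.card κ * empiricalVariance fun i => V i ω))) ∂μ ≤
      Real.exp (-(Fintype.card κ * ((τ - τ ^ 2 * C ^ 2) * v))) := by
  classical
  have := h.measurable
  let F (σ : Equiv.Perm ι) (ω : Ω) : ℝ :=
    Real.exp (-(τ * ∑ k, ‖V (σ (e (k, true))) ω - V (σ (e (k, false))) ω‖ ^ 2 / 2))
  have integrable_F : ∀ σ, Integrable (F σ) μ := fun σ =>
    Integrable.of_bound (by fun_prop : Measurable (F σ)).aestronglyMeasurable 1
      (ae_of_all _ fun ω => by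
        rw [Real.norm_of_nonneg (Real.exp_pos _).le, Real.exp_le_one_iff]
        exact neg_nonpos.2 (by positivity))
  calc _ ≤ ∫ ω, ∑ σ : Equiv.Perm ι, (1 / Fintype.card (Equiv.Perm ι) : ℝ) * F σ ω ∂μ :=
        integral_mono_of_nonneg (ae_of_all _ fun ω => (Real.exp_pos _).le)
          (integrable_finsetSum _ fun σ _ => (integrable_F σ).const_mul _)
          (ae_of_all _ fun ω => exp_neg_empiricalVariance_le_average e (fun i => V i ω) τ)
    _ = ∑ σ : Equiv.Perm ι, (1 / Fintype.card (Equiv.Perm ι) : ℝ) * ∫ ω, F σ ω ∂μ := by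
        rw [integral_finsetSum _ fun σ _ => (integrable_F σ).const_mul _]
        exact Finset.sum_congr rfl fun σ _ => integral_const_mul _ _
    _ ≤ ∑ _σ : Equiv.Perm ι, (1 / Fintype.card (Equiv.Perm ι) : ℝ) *
          Real.exp (-(Fintype.card κ * ((τ - τ ^ 2 * C ^ 2) * v))) := by
        gcongr with σ
        exact h.integral_exp_neg_sum_pairs_le (e.trans σ.toEmbedding) hτ
    _ = _ := by
        rw [Finset.sum_const, Finset.card_univ, nsmul_eq_mul, ← mul_assoc,
          mul_one_div_cancel (by simp), one_mul]

theorem integral_exp_neg_empiricalVariance_le (h : BoundedSample V ν v C μ) {τ : ℝ}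
    (hτ : 0 ≤ τ) :
    ∫ ω, Real.exp (-(τ * empiricalVariance fun i => V i ω)) ∂μ ≤
      Real.exp (-(τ * v) + 2 * τ ^ 2 * v * C ^ 2 / ((Fintype.card ι : ℝ) - 1)) := by
  set m : ℕ := Fintype.card ι / 2
  obtain ⟨e⟩ : Nonempty (Fin m × Bool ↪ ι) :=
    Function.Embedding.nonempty_of_card_le (by
      rw [Fintype.card_prod, Fintype.card_fin, Fintype.card_bool]
      exact Nat.div_mul_le_self _ 2)
  have hN := card_sub_one_pos ι
  have half_le : ((Fintype.card ι : ℝ) - 1) / 2 ≤ m := by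
    have : Fintype.card ι ≤ 2 * m + 1 := by omega
    have : (Fintype.card ι : ℝ) ≤ 2 * m + 1 := by exact_mod_cast this
    linarith
  have hm : (0 : ℝ) < m := by linarith
  have inv_le : 1 / (m : ℝ) ≤ 2 / ((Fintype.card ι : ℝ) - 1) :=
    (one_div_le_one_div_of_le (by linarith) half_le).trans_eq (one_div_div _ _)
  calc ∫ ω, Real.exp (-(τ * empiricalVariance fun i => V i ω)) ∂μ
      = ∫ ω, Real.exp (-(τ / m * (m * empiricalVariance fun i => V i ω))) ∂μ := by
        simp only [← mul_assoc, div_mul_cancel₀ τ hm.ne']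
    _ ≤ Real.exp (-(m * ((τ / m - (τ / m) ^ 2 * C ^ 2) * v))) := by
        simpa only [Fintype.card_fin] using
          h.integral_exp_neg_card_mul_empiricalVariance_le e (div_nonneg hτ hm.le)
    _ = Real.exp (-(τ * v) + τ ^ 2 * v * C ^ 2 * (1 / m)) := by
        congr 1
        field_simp
        ring
    _ ≤ Real.exp (-(τ * v) + τ ^ 2 * v * C ^ 2 * (2 / ((Fintype.card ι : ℝ) - 1))) := by
        have := h.variance_nonneg
        gcongr
    _ = _ := by ring_nf

theorem integral_exp_mul_sqrt_sub_sqrt_le (h : BoundedSample V ν v C μ) {θ : ℝ} (hv : 0 < v)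
    (hθ : 0 ≤ θ) :
    ∫ ω, Real.exp (θ * (√v - √(empiricalVariance fun i => V i ω))) ∂μ ≤
      2 * Real.exp (2 * θ ^ 2 * C ^ 2 / ((Fintype.card ι : ℝ) - 1)) := by
  have hN := card_sub_one_pos ι
  have hσ : 0 < √v := Real.sqrt_pos.2 hv
  have measurable_U := measurable_empiricalVariance h.measurable
  have integrable_exp :
      Integrable (fun ω => Real.exp (-(θ / √v * empiricalVariance fun i => V i ω))) μ :=
    Integrable.of_bound (measurable_U.const_mul _).neg.exp.aestronglyMeasurable 1
      (ae_of_all _ fun ω => by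
        rw [Real.norm_of_nonneg (Real.exp_pos _).le, Real.exp_le_one_iff]
        exact neg_nonpos.2 (mul_nonneg (by positivity) (empiricalVariance_nonneg _)))
  calc _ ≤ ∫ ω, (1 + Real.exp (θ * √v) *
          Real.exp (-(θ / √v * empiricalVariance fun i => V i ω))) ∂μ :=
        integral_mono_of_nonneg (ae_of_all _ fun ω => (Real.exp_pos _).le)
          ((integrable_const 1).add (integrable_exp.const_mul _))
          (ae_of_all _ fun ω => exp_sub_sqrt_le hθ hσ (empiricalVariance_nonneg _))
    _ = 1 + Real.exp (θ * √v) *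
          ∫ ω, Real.exp (-(θ / √v * empiricalVariance fun i => V i ω)) ∂μ := by
        rw [integral_add (integrable_const 1) (integrable_exp.const_mul _), integral_const_mul,
          integral_const, probReal_univ, one_smul]
    _ ≤ 1 + Real.exp (θ * √v) * Real.exp (-(θ / √v * v) +
          2 * (θ / √v) ^ 2 * v * C ^ 2 / ((Fintype.card ι : ℝ) - 1)) := by
        gcongr
        exact h.integral_exp_neg_empiricalVariance_le (by positivity)
    _ = 1 + Real.exp (2 * θ ^ 2 * C ^ 2 / ((Fintype.card ι : ℝ) - 1)) := by
        rw [← Real.exp_add, div_pow, Real.sq_sqrt hv.le, div_mul_eq_mul_div, mul_div_assoc θ v,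
          Real.div_sqrt]
        congr 2
        field_simp
        ring
    _ ≤ _ := by
        have : 0 ≤ 2 * θ ^ 2 * C ^ 2 / ((Fintype.card ι : ℝ) - 1) := by positivity
        linarith [Real.one_le_exp this]

/- The exponential moment is taken at `θ = (N - 1) * r / (2 * C)` with `r = √(2 * L / (N - 1))`,
which makes the exponent of the preceding lemma exactly `L`. -/
theorem hasChernoffBound_sqrt_variance_sub (h : BoundedSample V ν v C μ) {L : ℝ} (hL : 0 < L) :
    HasChernoffBound (fun ω => √v - √(empiricalVariance fun i => V i ω) -
      2 * C * √(2 * L / ((Fintype.card ι : ℝ) - 1))) (2 * Real.exp (-L)) μ := by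
  have hN := card_sub_one_pos ι
  set N := (Fintype.card ι : ℝ)
  set r := √(2 * L / (N - 1))
  have hr : 0 < r := Real.sqrt_pos.2 (by positivity)
  have r_sq : (N - 1) * r ^ 2 = 2 * L := by
    rw [Real.sq_sqrt (by positivity), mul_div_cancel₀ _ hN.ne']
  rcases h.variance_nonneg.eq_or_lt' with hv | hv
  · left
    refine ae_of_all _ fun ω => ?_
    rw [hv, Real.sqrt_zero]
    linarith [Real.sqrt_nonneg (empiricalVariance fun i => V i ω), mul_nonneg h.bound_nonneg hr.le]
  · right
    have hC : 0 < C := h.bound_nonneg.lt_of_ne' fun hC => by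
      have := h.variance_le
      rw [hC] at this
      linarith
    set θ := (N - 1) * r / (2 * C)
    have hθ : 0 < θ := by positivity
    have θ_mul : θ * (2 * C) = (N - 1) * r := div_mul_cancel₀ _ (by positivity)
    have factor : ∀ ω, Real.exp ((√v - √(empiricalVariance fun i => V i ω) - 2 * C * r) / θ⁻¹) =
        Real.exp (-(2 * L)) * Real.exp (θ * (√v - √(empiricalVariance fun i => V i ω))) :=
      fun ω => by
        rw [← Real.exp_add, div_inv_eq_mul]
        congr 1
        linear_combination -r * θ_mul - r_sq
    have exponent_eq : 2 * θ ^ 2 * C ^ 2 / (N - 1) = L := by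
      rw [div_eq_iff hN.ne']
      linear_combination (θ * (2 * C) + (N - 1) * r) / 2 * θ_mul + (N - 1) / 2 * r_sq
    refine ⟨θ⁻¹, inv_pos.2 hθ, ?_, ?_⟩ <;> simp only [factor]
    · exact (h.integrable_exp_mul_sqrt_sub_sqrt hθ.le).const_mul _
    · rw [integral_const_mul]
      calc _ ≤ Real.exp (-(2 * L)) * (2 * Real.exp (2 * θ ^ 2 * C ^ 2 / (N - 1))) := by
            gcongr
            exact h.integral_exp_mul_sqrt_sub_sqrt_le hv hθ.le
        _ = 2 * Real.exp (-L) := by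
            rw [exponent_eq, mul_left_comm, ← Real.exp_add]
            ring_nf

theorem hasChernoffBound_norm_empiricalMean_sub (h : BoundedSample V ν v C μ) {L : ℝ}
    (hL : 0 < L) :
    HasChernoffBound (fun ω => ‖empiricalMean (fun i => V i ω) - ν‖ -
      (√(2 * L / Fintype.card ι) * √v + 2 * C * L / (3 * Fintype.card ι)))
      (2 * Real.exp (-L)) μ := by
  have hN : (0 : ℝ) < Fintype.card ι := one_pos.trans (one_lt_card_cast ι)
  have bernstein := (hasChernoffBound_norm_sum (X := fun i ω => V i ω - ν)
    (fun i => (h.measurable i).sub_const ν)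
    (h.iIndepFun.comp (fun _ x => x - ν) fun _ => by fun_prop) h.ae_norm_sub_mean_le
    h.integral_sub_mean (mul_nonneg zero_le_two h.bound_nonneg) hL).const_mul (one_div_pos.2 hN)
  simp only [h.integral_norm_sub_sq, Finset.sum_const, Finset.card_univ, nsmul_eq_mul]
    at bernstein
  convert bernstein using 2 with ω
  have norm_eq : ‖empiricalMean (fun i => V i ω) - ν‖ =
      1 / (Fintype.card ι : ℝ) * ‖∑ i, (V i ω - ν)‖ := by
    rw [empiricalMean_sub, norm_smul, Real.norm_of_nonneg (one_div_pos.2 hN).le]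
  have sqrt_eq : √(2 * L * (Fintype.card ι * v)) =
      Fintype.card ι * (√(2 * L / Fintype.card ι) * √v) := by
    rw [← Real.sqrt_mul (by positivity), ← Real.sqrt_sq hN.le, ← Real.sqrt_mul (by positivity),
      Real.sqrt_sq hN.le]
    congr 1
    field_simp
  rw [norm_eq, sqrt_eq]
  field_simp

end BoundedSample

end Samples

section EmpiricalBernstein

variable {ι E : Type*} [Fintype ι] [NormedAddCommGroup E] [InnerProductSpace ℝ E]

/-- The radius of the empirical Bernstein confidence ball around the mean of a finite family of
vectors bounded by `C` in norm, the failure probability being proportional to `exp (-L)`. -/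
noncomputable def empiricalBernsteinRadius (C L : ℝ) (x : ι → E) : ℝ :=
  √(2 * L / Fintype.card ι) * √(empiricalVariance x) + 14 / 3 * C * L / ((Fintype.card ι : ℝ) - 1)

theorem sqrt_mul_sqrt_add_le {N C L : ℝ} (hN : 1 < N) (hC : 0 ≤ C) (hL : 0 ≤ L) :
    √(2 * L / N) * (2 * C * √(2 * L / (N - 1))) + 2 * C * L / (3 * N) ≤
      14 / 3 * C * L / (N - 1) := by
  have hN1 : 0 < N - 1 := sub_pos.2 hN
  calc _ ≤ √(2 * L / (N - 1)) * (2 * C * √(2 * L / (N - 1))) + 2 * C * L / (3 * (N - 1)) := by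
        gcongr <;> linarith
    _ = 2 * C * √(2 * L / (N - 1)) ^ 2 + 2 * C * L / (3 * (N - 1)) := by ring
    _ = _ := by
        rw [Real.sq_sqrt (by positivity)]
        field_simp
        ring

variable [Nontrivial ι]

theorem bernstein_radius_le_empirical {C L : ℝ} (hC : 0 ≤ C) (hL : 0 ≤ L) (σ : ℝ) (x : ι → E) :
    √(2 * L / Fintype.card ι) * σ + 2 * C * L / (3 * Fintype.card ι) ≤
      empiricalBernsteinRadius C L x + √(2 * L / Fintype.card ι) *
        (σ - √(empiricalVariance x) - 2 * C * √(2 * L / ((Fintype.card ι : ℝ) - 1))) := by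
  rw [empiricalBernsteinRadius]
  linarith [sqrt_mul_sqrt_add_le (one_lt_card_cast ι) hC hL]

theorem sqrt_mul_sqrt_empiricalVariance {L : ℝ} (hL : 0 ≤ L) (x : ι → E) :
    √(2 * L / Fintype.card ι) * √(empiricalVariance x) =
      √(2 * (∑ i, ‖x i - empiricalMean x‖ ^ 2) * L /
        (Fintype.card ι * ((Fintype.card ι : ℝ) - 1))) := by
  rw [← Real.sqrt_mul (by positivity), empiricalVariance, div_mul_div_comm]
  ring_nf

theorem empiricalBernsteinRadius_le_two_mul_sqrt {C L : ℝ} (hC : 0 ≤ C) (hL : 0 ≤ L) (x : ι → E) :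
    empiricalBernsteinRadius C L x ≤
      2 * √((∑ i, ‖x i - empiricalMean x‖ ^ 2) * L) / Fintype.card ι +
        10 * C * L / ((Fintype.card ι : ℝ) - 1) := by
  have hN1 := card_sub_one_pos ι
  have two_le_card : (2 : ℝ) ≤ Fintype.card ι := by exact_mod_cast Fintype.one_lt_card (α := ι)
  rw [empiricalBernsteinRadius, sqrt_mul_sqrt_empiricalVariance hL]
  set N := (Fintype.card ι : ℝ)
  set S := ∑ i, ‖x i - empiricalMean x‖ ^ 2
  have : 0 ≤ S := Finset.sum_nonneg fun _ _ => sq_nonneg _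
  gcongr
  · refine Real.sqrt_le_iff.2 ⟨by positivity, ?_⟩
    rw [div_pow, mul_pow, Real.sq_sqrt (by positivity)]
    calc 2 * S * L / (N * (N - 1)) ≤ 2 * S * L / (N * (N / 2)) := by
          gcongr
          linarith
      _ = 2 ^ 2 * (S * L) / N ^ 2 := by
          field_simp
  · norm_num

theorem empiricalBernsteinRadius_le_sqrt {L : ℝ} (hL : 0 ≤ L) (C : ℝ) (x : ι → E) :
    empiricalBernsteinRadius C L x ≤
      √(2 * (∑ i, ‖x i - empiricalMean x‖ ^ 2) * L) / ((Fintype.card ι : ℝ) - 1) +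
        14 * C * L / (3 * ((Fintype.card ι : ℝ) - 1)) := by
  have hN1 := card_sub_one_pos ι
  rw [empiricalBernsteinRadius, sqrt_mul_sqrt_empiricalVariance hL]
  set N := (Fintype.card ι : ℝ)
  set S := ∑ i, ‖x i - empiricalMean x‖ ^ 2
  have : 0 ≤ S := Finset.sum_nonneg fun _ _ => sq_nonneg _
  refine add_le_add ?_ (le_of_eq (by field_simp))
  refine Real.sqrt_le_iff.2 ⟨by positivity, ?_⟩
  rw [div_pow, Real.sq_sqrt (by positivity), sq (N - 1)]
  gcongr
  linarith

variable {Ω J : Type*} [MeasurableSpace Ω] [Fintype J] {μ : Measure Ω} [IsProbabilityMeasure μ]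
  [CompleteSpace E] [MeasurableSpace E] [BorelSpace E] [SecondCountableTopology E]

theorem measure_sum_empiricalBernsteinRadius_lt_le {V : J → ι → Ω → E} {ν : J → E}
    {v C : J → ℝ} (h : ∀ j, BoundedSample (V j) (ν j) (v j) (C j) μ) {L : ℝ} (hL : 0 < L) :
    μ {ω | ∑ j, empiricalBernsteinRadius (C j) L (fun i => V j i ω) <
        ∑ j, ‖empiricalMean (fun i => V j i ω) - ν j‖} ≤ ENNReal.ofReal (4 * Real.exp (-L)) := by
  have := one_pos.trans (one_lt_card_cast ι)
  let meanError (j : J) (ω : Ω) : ℝ := ‖empiricalMean (fun i => V j i ω) - ν j‖ -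
    (√(2 * L / Fintype.card ι) * √(v j) + 2 * C j * L / (3 * Fintype.card ι))
  let deviationError (j : J) (ω : Ω) : ℝ := √(2 * L / Fintype.card ι) *
    (√(v j) - √(empiricalVariance fun i => V j i ω) -
      2 * C j * √(2 * L / ((Fintype.card ι : ℝ) - 1)))
  have mean_bound : μ {ω | 0 < ∑ j, meanError j ω} ≤ ENNReal.ofReal (2 * Real.exp (-L)) :=
    measure_sum_pos_le_of_hasChernoffBound _ fun j _ =>
      (h j).hasChernoffBound_norm_empiricalMean_sub hL
  have deviation_bound :
      μ {ω | 0 < ∑ j, deviationError j ω} ≤ ENNReal.ofReal (2 * Real.exp (-L)) :=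
    measure_sum_pos_le_of_hasChernoffBound _ fun j _ =>
      ((h j).hasChernoffBound_sqrt_variance_sub hL).const_mul (by positivity)
  have split : ∀ ω, ∑ j, ‖empiricalMean (fun i => V j i ω) - ν j‖ ≤
      ∑ j, empiricalBernsteinRadius (C j) L (fun i => V j i ω) +
        (∑ j, meanError j ω + ∑ j, deviationError j ω) := fun ω => by
    simp only [← Finset.sum_add_distrib]
    refine Finset.sum_le_sum fun j _ => ?_
    linarith [bernstein_radius_le_empirical (h j).bound_nonneg hL.le (√(v j)) fun i => V j i ω]
  calc _ ≤ μ ({ω | 0 < ∑ j, meanError j ω} ∪ {ω | 0 < ∑ j, deviationError j ω}) := by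
        refine measure_mono fun ω hω => ?_
        simp only [Set.mem_union, Set.mem_ofPred_eq] at hω ⊢
        by_contra! nonpos
        linarith [split ω]
    _ ≤ ENNReal.ofReal (2 * Real.exp (-L)) + ENNReal.ofReal (2 * Real.exp (-L)) :=
        (measure_union_le _ _).trans (add_le_add mean_bound deviation_bound)
    _ = _ := by
        rw [← ENNReal.ofReal_add (by positivity) (by positivity)]
        ring_nf

theorem BoundedSample.measure_empiricalBernsteinRadius_lt_le {V : ι → Ω → E} {ν : E} {v C : ℝ}
    (h : BoundedSample V ν v C μ) {L : ℝ} (hL : 0 < L) :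
    μ {ω | empiricalBernsteinRadius C L (fun i => V i ω) <
        ‖empiricalMean (fun i => V i ω) - ν‖} ≤ ENNReal.ofReal (4 * Real.exp (-L)) := by
  simpa only [Finset.univ_unique, Finset.sum_singleton] using
    measure_sum_empiricalBernsteinRadius_lt_le (J := Unit) (fun _ => h) hL

theorem measure_iSup_empiricalBernsteinRadius_lt_le [Nonempty J] {V : J → ι → Ω → E} {ν : J → E}
    {v C : J → ℝ} (h : ∀ j, BoundedSample (V j) (ν j) (v j) (C j) μ) {L : ℝ} (hL : 0 < L) :
    μ {ω | ⨆ j, empiricalBernsteinRadius (C j) L (fun i => V j i ω) <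
        ⨆ j, ‖empiricalMean (fun i => V j i ω) - ν j‖} ≤
      ENNReal.ofReal (Fintype.card J * (4 * Real.exp (-L))) := by
  calc _ ≤ μ (⋃ j, {ω | empiricalBernsteinRadius (C j) L (fun i => V j i ω) <
          ‖empiricalMean (fun i => V j i ω) - ν j‖}) := by
        refine measure_mono fun ω hω => ?_
        simp only [Set.mem_iUnion, Set.mem_ofPred_eq] at hω ⊢
        by_contra! mean_le
        exact hω.not_ge (ciSup_mono (Set.finite_range _).bddAbove mean_le)
    _ ≤ ∑ _j : J, ENNReal.ofReal (4 * Real.exp (-L)) :=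
        (measure_iUnion_fintype_le _ _).trans
          (Finset.sum_le_sum fun j _ => (h j).measure_empiricalBernsteinRadius_lt_le hL)
    _ = _ := by
        rw [Finset.sum_const, Finset.card_univ, nsmul_eq_mul, ← ENNReal.ofReal_natCast,
          ← ENNReal.ofReal_mul (by positivity)]

end EmpiricalBernstein

theorem four_mul_exp_neg_log_div {a δ : ℝ} (ha : 0 < a) (hδ : 0 < δ) :
    4 * Real.exp (-Real.log (a / δ)) = 4 / a * δ := by
  rw [← Real.log_inv, Real.exp_log (by positivity)]
  field_simp

section BoundedSampleConstruction

variable {Ω ι κ : Type*} [MeasurableSpace Ω] [Fintype κ] {μ : Measure Ω} [IsProbabilityMeasure μ]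
  {V : ι → Ω → κ → ℝ} {ν v : κ → ℝ}

theorem boundedSample_apply (hmeas : ∀ i, Measurable (V i)) (hindep : iIndepFun V μ)
    (hν : ∀ i, ν = ∫ ω, V i ω ∂μ) (hvar : ∀ i j, Var[fun ω => V i ω j; μ] = v j) {C : κ → ℝ}
    (hC : ∀ i, ∀ᵐ ω ∂μ, ∀ j, |V i ω j| ≤ C j) (j : κ) :
    BoundedSample (fun i ω => V i ω j) (ν j) (v j) (C j) μ := by
  have measurable_coord : ∀ i j, Measurable fun ω => V i ω j := fun i j =>
    (measurable_pi_apply j).comp (hmeas i)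
  have integral_coord : ∀ i, ∫ ω, V i ω j ∂μ = ν j := fun i => by
    rw [hν i, eval_integral fun j => Integrable.of_bound
      (measurable_coord i j).aestronglyMeasurable (C j) ((hC i).mono fun ω hω => hω j)]
  refine ⟨fun i => measurable_coord i j,
    hindep.comp (fun _ x => x j) fun _ => measurable_pi_apply j,
    fun i => (hC i).mono fun ω hω => hω j, integral_coord, fun i => ?_⟩
  rw [← hvar i j, variance_eq_integral (measurable_coord i j).aemeasurable, integral_coord i]
  simp only [Real.norm_eq_abs, sq_abs]

theorem boundedSample_toLp (hmeas : ∀ i, Measurable (V i)) (hindep : iIndepFun V μ)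
    (hν : ∀ i, ν = ∫ ω, V i ω ∂μ) (hvar : ∀ i j, Var[fun ω => V i ω j; μ] = v j) {C : ℝ}
    (hC : ∀ i, ∀ᵐ ω ∂μ, ‖(WithLp.toLp 2 (V i ω) : EuclideanSpace ℝ κ)‖ ≤ C) :
    BoundedSample (fun i ω => (WithLp.toLp 2 (V i ω) : EuclideanSpace ℝ κ)) (WithLp.toLp 2 ν)
      (∑ j, v j) C μ := by
  have coordinate : ∀ j, BoundedSample (fun i ω => V i ω j) (ν j) (v j) C μ :=
    boundedSample_apply (C := fun _ => C) hmeas hindep hν hvar fun i =>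
      (hC i).mono fun ω hω j => (PiLp.norm_apply_le (WithLp.toLp 2 (V i ω)) j).trans hω
  refine ⟨fun i => (WithLp.measurable_toLp 2 _).comp (hmeas i),
    hindep.comp (fun _ => WithLp.toLp 2) fun _ => WithLp.measurable_toLp 2 _, hC, fun i => ?_,
    fun i => ?_⟩
  · rw [hν i]
    exact (PiLp.continuousLinearEquiv 2 ℝ (fun _ : κ => ℝ)).symm.integral_comp_comm _
  · simp only [← WithLp.toLp_sub, EuclideanSpace.norm_sq_eq, Pi.sub_apply]
    rw [integral_finsetSum _ fun j _ =>
      ((coordinate j).memLp_sub_mean i).integrable_norm_pow two_ne_zero]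
    exact Finset.sum_congr rfl fun j _ => (coordinate j).integral_norm_sub_sq i

end BoundedSampleConstruction

section VecNorm

variable {Ω : Type*} {n d : ℕ} {V : Fin n → Ω → Fin d → ℝ}

theorem empiricalMean_coordinate (ω : Ω) (j : Fin d) :
    empiricalMean (fun i => V i ω j) = sampleMean V ω j := by
  simp only [empiricalMean, sampleMean, Fintype.card_fin, Pi.smul_apply, Finset.sum_apply]

theorem empiricalMean_toLp (ω : Ω) :
    empiricalMean (fun i => (WithLp.toLp 2 (V i ω) : EuclideanSpace ℝ (Fin d))) =
      WithLp.toLp 2 (sampleMean V ω) := by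
  rw [empiricalMean, sampleMean, WithLp.toLp_smul, WithLp.toLp_sum, Fintype.card_fin]

variable [MeasurableSpace Ω] {μ : Measure Ω} [IsProbabilityMeasure μ] [Nontrivial (Fin n)]
  {ν : Fin d → ℝ} {δ : ℝ}

theorem measure_vecNorm_two_gt_le {v C : ℝ}
    (h : BoundedSample (fun i ω => (WithLp.toLp 2 (V i ω) : EuclideanSpace ℝ (Fin d)))
      (WithLp.toLp 2 ν) v C μ) (hδ : 0 < δ) (hδ1 : δ < 1) :
    μ {ω | vecNorm 2 (sampleMean V ω - ν) >
        2 * √((∑ i, vecNorm 2 (V i ω - sampleMean V ω) ^ 2) * Real.log (6 / δ)) / (n : ℝ)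
          + 10 * C * Real.log (6 / δ) / ((n : ℝ) - 1)} ≤ ENNReal.ofReal δ := by
  have hL : 0 < Real.log (6 / δ) := Real.log_pos ((one_lt_div hδ).2 (by linarith))
  have failure_le : 4 * Real.exp (-Real.log (6 / δ)) ≤ δ := by
    rw [four_mul_exp_neg_log_div (by norm_num) hδ]
    linarith
  refine (measure_mono fun ω hω => ?_).trans
    ((h.measure_empiricalBernsteinRadius_lt_le hL).trans (ENNReal.ofReal_le_ofReal failure_le))
  refine (empiricalBernsteinRadius_le_two_mul_sqrt h.bound_nonneg hL.le _).trans_lt ?_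
  simpa only [empiricalMean_toLp, ← WithLp.toLp_sub, Fintype.card_fin, vecNorm, gt_iff_lt,
    Set.mem_ofPred_eq] using hω

variable {v C : Fin d → ℝ}

theorem measure_vecNorm_top_gt_le [Nonempty (Fin d)]
    (h : ∀ j, BoundedSample (fun i ω => V i ω j) (ν j) (v j) (C j) μ) (hδ : 0 < δ) (hδ1 : δ < 1) :
    μ {ω | vecNorm ∞ (sampleMean V ω - ν) >
        ⨆ j : Fin d,
          (√(2 * (∑ i, (V i ω j - sampleMean V ω j) ^ 2) * Real.log (4 * (d : ℝ) / δ))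
              / ((n : ℝ) - 1)
            + 14 * C j * Real.log (4 * (d : ℝ) / δ) / (3 * ((n : ℝ) - 1)))}
      ≤ ENNReal.ofReal δ := by
  have hd : (1 : ℝ) ≤ d := by exact_mod_cast Fin.pos_iff_nonempty.2 ‹_›
  have hL : 0 < Real.log (4 * d / δ) := Real.log_pos ((one_lt_div hδ).2 (by linarith))
  have failure_eq : Fintype.card (Fin d) * (4 * Real.exp (-Real.log (4 * d / δ))) = δ := by
    rw [four_mul_exp_neg_log_div (by positivity) hδ, Fintype.card_fin]
    field_simp
  refine (measure_mono fun ω hω => ?_).trans ((measure_iSup_empiricalBernsteinRadius_lt_le h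
    hL).trans_eq (congrArg ENNReal.ofReal failure_eq))
  refine (ciSup_mono (Set.finite_range _).bddAbove fun j =>
    empiricalBernsteinRadius_le_sqrt hL.le (C j) _).trans_lt ?_
  simpa only [empiricalMean_coordinate, Fintype.card_fin, vecNorm, PiLp.norm_eq_ciSup,
    Pi.sub_apply, Real.norm_eq_abs, sq_abs, gt_iff_lt, Set.mem_ofPred_eq] using hω

theorem measure_vecNorm_one_gt_le
    (h : ∀ j, BoundedSample (fun i ω => V i ω j) (ν j) (v j) (C j) μ) (hδ : 0 < δ) (hδ1 : δ < 1) :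
    μ {ω | vecNorm 1 (sampleMean V ω - ν) >
        ∑ j : Fin d,
          (9 / 4 * √(2 * (∑ i, (V i ω j - sampleMean V ω j) ^ 2) * Real.log (30 / δ))
              / ((n : ℝ) - 1)
            + 25 * C j * Real.log (30 / δ) / ((n : ℝ) - 1))}
      ≤ ENNReal.ofReal δ := by
  have hL : 0 < Real.log (30 / δ) := Real.log_pos ((one_lt_div hδ).2 (by linarith))
  have failure_le : 4 * Real.exp (-Real.log (30 / δ)) ≤ δ := by
    rw [four_mul_exp_neg_log_div (by norm_num) hδ]
    linarith
  have relax : ∀ (x : Fin n → ℝ) (j : Fin d), empiricalBernsteinRadius (C j) (Real.log (30 / δ)) x ≤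
      9 / 4 * √(2 * (∑ i, (x i - empiricalMean x) ^ 2) * Real.log (30 / δ)) / ((n : ℝ) - 1) +
        25 * C j * Real.log (30 / δ) / ((n : ℝ) - 1) := fun x j => by
    have hn := card_sub_one_pos (Fin n)
    have := (h j).bound_nonneg
    have radius_le := empiricalBernsteinRadius_le_sqrt hL.le (C j) x
    simp only [Fintype.card_fin, Real.norm_eq_abs, sq_abs] at hn radius_le
    refine radius_le.trans ?_
    calc _ = 1 * √(2 * (∑ i, (x i - empiricalMean x) ^ 2) * Real.log (30 / δ)) / ((n : ℝ) - 1) +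
          14 / 3 * C j * Real.log (30 / δ) / ((n : ℝ) - 1) := by
          rw [one_mul]
          field_simp
      _ ≤ _ := by gcongr <;> norm_num
  refine (measure_mono fun ω hω => ?_).trans ((measure_sum_empiricalBernsteinRadius_lt_le h
    hL).trans (ENNReal.ofReal_le_ofReal failure_le))
  refine (Finset.sum_le_sum fun j _ => relax (fun i => V i ω j) j).trans_lt ?_
  simpa only [empiricalMean_coordinate, vecNorm, PiLp.norm_eq_of_L1, Pi.sub_apply,
    gt_iff_lt, Set.mem_ofPred_eq] using hω

end VecNorm

theorem mainTheorem5_general {Ω : Type*} [MeasurableSpace Ω] (μ : Measure Ω)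
    [IsProbabilityMeasure μ] (n d : ℕ) (hn : 2 ≤ n) (hd : 1 ≤ d)
    (V : Fin n → Ω → Fin d → ℝ)
    (hmeas : ∀ i, Measurable (V i))
    (hindep : iIndepFun V μ)
    (hvar : ∀ i i' j, Var[fun ω => V i ω j; μ] = Var[fun ω => V i' ω j; μ])
    (ν : Fin d → ℝ) (hν : ∀ i, ν = ∫ ω, V i ω ∂μ) :
    (∀ C : ℝ, (∀ i, ∀ᵐ ω ∂μ, vecNorm 2 (V i ω) ≤ C) →
      ∀ δ : ℝ, 0 < δ → δ < 1 →
        μ {ω | vecNorm 2 (sampleMean V ω - ν) >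
            2 * √((∑ i, vecNorm 2 (V i ω - sampleMean V ω) ^ 2) * Real.log (6 / δ)) / (n : ℝ)
              + 10 * C * Real.log (6 / δ) / ((n : ℝ) - 1)} ≤ ENNReal.ofReal δ) ∧
    (∀ C : Fin d → ℝ, (∀ i, ∀ᵐ ω ∂μ, ∀ j, |V i ω j| ≤ C j) →
      ∀ δ : ℝ, 0 < δ → δ < 1 →
        (μ {ω | vecNorm ∞ (sampleMean V ω - ν) >
            ⨆ j : Fin d,
              (√(2 * (∑ i, (V i ω j - sampleMean V ω j) ^ 2) * Real.log (4 * (d : ℝ) / δ))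
                  / ((n : ℝ) - 1)
                + 14 * C j * Real.log (4 * (d : ℝ) / δ) / (3 * ((n : ℝ) - 1)))}
          ≤ ENNReal.ofReal δ) ∧
        (μ {ω | vecNorm 1 (sampleMean V ω - ν) >
            ∑ j : Fin d,
              (9 / 4 * √(2 * (∑ i, (V i ω j - sampleMean V ω j) ^ 2) * Real.log (30 / δ))
                  / ((n : ℝ) - 1)
                + 25 * C j * Real.log (30 / δ) / ((n : ℝ) - 1))}
          ≤ ENNReal.ofReal δ)) := by
  have : Nontrivial (Fin n) := Fin.nontrivial_iff_two_le.2 hn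
  have : Nonempty (Fin d) := Fin.pos_iff_nonempty.1 hd
  let i₀ : Fin n := ⟨0, by omega⟩
  refine ⟨fun C hC δ hδ hδ1 => ?_, fun C hC δ hδ hδ1 => ?_⟩
  · exact measure_vecNorm_two_gt_le
      (boundedSample_toLp hmeas hindep hν (fun i j => hvar i i₀ j) hC) hδ hδ1
  · have coordinate := boundedSample_apply hmeas hindep hν (fun i j => hvar i i₀ j) hC
    exact ⟨measure_vecNorm_top_gt_le coordinate hδ hδ1,
      measure_vecNorm_one_gt_le coordinate hδ hδ1⟩

theorem mainTheorem5 {Ω : Type*} [MeasurableSpace Ω] (μ : Measure Ω) [IsProbabilityMeasure μ]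
    (n d : ℕ) (hn : 2 ≤ n) (hd : 1 ≤ d)
    (V : Fin n → Ω → Fin d → ℝ)
    (hmeas : ∀ i, Measurable (V i))
    (hindep : iIndepFun V μ)
    (hident : ∀ i i', IdentDistrib (V i) (V i') μ μ)
    (ν : Fin d → ℝ) (hν : ∀ i, ν = ∫ ω, V i ω ∂μ) :
    (∀ C : ℝ, (∀ i, ∀ᵐ ω ∂μ, vecNorm 2 (V i ω) ≤ C) →
      ∀ δ : ℝ, 0 < δ → δ < 1 →
        μ {ω | vecNorm 2 (sampleMean V ω - ν) >
            2 * √((∑ i, vecNorm 2 (V i ω - sampleMean V ω) ^ 2) * Real.log (6 / δ)) / (n : ℝ)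
              + 10 * C * Real.log (6 / δ) / ((n : ℝ) - 1)} ≤ ENNReal.ofReal δ) ∧
    (∀ C : Fin d → ℝ, (∀ i, ∀ᵐ ω ∂μ, ∀ j, |V i ω j| ≤ C j) →
      ∀ δ : ℝ, 0 < δ → δ < 1 →
        (μ {ω | vecNorm ∞ (sampleMean V ω - ν) >
            ⨆ j : Fin d,
              (√(2 * (∑ i, (V i ω j - sampleMean V ω j) ^ 2) * Real.log (4 * (d : ℝ) / δ))
                  / ((n : ℝ) - 1)
                + 14 * C j * Real.log (4 * (d : ℝ) / δ) / (3 * ((n : ℝ) - 1)))}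
          ≤ ENNReal.ofReal δ) ∧
        (μ {ω | vecNorm 1 (sampleMean V ω - ν) >
            ∑ j : Fin d,
              (9 / 4 * √(2 * (∑ i, (V i ω j - sampleMean V ω j) ^ 2) * Real.log (30 / δ))
                  / ((n : ℝ) - 1)
                + 25 * C j * Real.log (30 / δ) / ((n : ℝ) - 1))}
          ≤ ENNReal.ofReal δ)) :=
  mainTheorem5_general μ n d hn hd V hmeas hindep
    (fun i i' j => ((hident i i').comp (measurable_pi_apply j)).variance_eq) ν hν
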